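/- Let $N\ge 1$ and let $\omega_1,\dots,\omega_N>0$ be non-resonant, i.e. $\sum_i m_i\omega_i=0$ with $m_i\in\mathbb Z$ only if all $m_i=0$. Consider the control system $\dot x=Ax+Bu$ in $\mathbb R^{2N}$, $x=(x_1,y_1,\dots,x_N,y_N)$, $|u|\le 1$, given by $$\dot x_i=y_i,\qquad \dot y_i=-\omega_i^2x_i+u,\qquad i=1,\dots,N,$$ so that $B=(0,1,\dots,0,1)$. An admissible control on $[0,T]$ is a measurable function $u$ with $|u(t)|\le 1$ for almost every $t$, and motions are absolutely continuous solutions. For $p=(\xi_1,\eta_1,\dots,\xi_N,\eta_N)$ put $z_i=(\eta_i^2+\omega_i^{-2}\xi_i^2)^{1/2}$ and $$H_\Omega(p)=\frac1{(2\pi)^N}\int_0^{2\pi}\!\!\cdots\int_0^{2\pi}\Big|\sum_{i=1}^N z_i\cos\varphi_i\Big|\,d\varphi_1\cdots d\varphi_N ,$$ let $\Omega=\{x:(x,p)\le H_\Omega(p)\ \text{for all }p\}$ be the convex body with support function $H_\Omega$, and let $\rho(x)=\inf\{r>0: x\in r\Omega\}$, so that $x\in\partial(\rho(x)\Omega)$.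 For $x\ne 0$ let $p(x)\neq 0$ be a solution $p$ of $\rho(x)^{-1}x=\frac{\partial H_\Omega}{\partial p}(p)$, i.e. an outer normal to $\rho(x)\Omega$ at $x$ (it is unique up to a positive factor). A motion under the feedback $u=-\operatorname{sign}(B,p(x))$ is a motion $x$ with an admissible control $u$ such that, for almost every $t$ with $x(t)\neq0$, $u(t)=-\operatorname{sign}(B,p(x(t)))$ if $(B,p(x(t)))\ne 0$, with no further condition on $u(t)\in[-1,1]$ if $(B,p(x(t)))=0$. Write $\rho(t)=\rho(x(t))$ and, for a motion on $[0,T]$, $M=\min\{\rho(0),\rho(T),T\}$. Then: 1. As $M\to+\infty$, motions under the feedback $u=-\operatorname{sign}(B,p(x))$ satisfy $(\rho(0)-\rho(T))/T=1+o(1)$; that is, for every $\varepsilon>0$ there is $M_0$, depending only on $\varepsilon$ and $\omega_1,\dots,\omega_N$, such that $|(\rho(0)-\rho(T))/T-1|\le\varepsilon$ for every such motion with $M\ge M_0$. 2. Under any admissible control, $(\rho(0)-\rho(T))/T\le 1+o(1)$ as $M\to+\infty$; that is, for every $\varepsilon>0$ there is $M_0$, depending only on $\varepsilon$ and $\omega_1,\dots,\omega_N$,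 such that $(\rho(0)-\rho(T))/T\le 1+\varepsilon$ for every motion with $M\ge M_0$. -/

import Mathlib

open MeasureTheory

noncomputable section

namespace Oscillators

/-- Phase space `ℝ^{2N}` with its Euclidean structure; the coordinate `(0, i)` is the position
`x_i` and `(1, i)` the velocity `y_i` of the `i`-th oscillator (dually, `ξ_i` and `η_i`). -/
abbrev Phase (N : ℕ) : Type := EuclideanSpace ℝ (Fin 2 × Fin N)

/-- The block diagonal matrix of the uncontrolled system. -/
def matA {N : ℕ} (ω : Fin N → ℝ) : Matrix (Fin 2 × Fin N) (Fin 2 × Fin N) ℝ :=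
  Matrix.blockDiagonal fun i => !![0, 1; -(ω i) ^ 2, 0]

/-- The vector `B = (0, 1, …, 0, 1)`. -/
def vecB (N : ℕ) : Phase N := WithLp.toLp 2 fun j => (![0, 1] : Fin 2 → ℝ) j.1

/-- There are no nontrivial integer relations between the frequencies. -/
def NonResonant {N : ℕ} (ω : Fin N → ℝ) : Prop :=
  ∀ m : Fin N → ℤ, ∑ i, (m i : ℝ) * ω i = 0 → m = 0

/-- `z_i = (η_i² + ω_i⁻² ξ_i²)^{1/2}`. -/
def amplitude {N : ℕ} (ω : Fin N → ℝ) (p : Phase N) (i : Fin N) : ℝ :=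
  Real.sqrt (p (1, i) ^ 2 + (ω i ^ 2)⁻¹ * p (0, i) ^ 2)

/-- The average of `|∑ z_i cos φ_i|` over the torus `[0, 2π]^N`. -/
def torusAverage {N : ℕ} (z : Fin N → ℝ) : ℝ :=
  ((2 * Real.pi) ^ N)⁻¹ *
    ∫ φ in Set.Icc (fun _ : Fin N => (0 : ℝ)) (fun _ => 2 * Real.pi),
      |∑ i, z i * Real.cos (φ i)|

/-- The support function of `Ω`. -/
def supportΩ {N : ℕ} (ω : Fin N → ℝ) (p : Phase N) : ℝ := torusAverage (amplitude ω p)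

/-- The closed convex set with support function `supportΩ`. -/
def bodyΩ {N : ℕ} (ω : Fin N → ℝ) : Set (Phase N) :=
  {x | ∀ p : Phase N, inner ℝ x p ≤ supportΩ ω p}

/-- The radial coordinate: `x = ρ(x) φ` with `φ ∈ ∂Ω`. -/
def rho {N : ℕ} (ω : Fin N → ℝ) (x : Phase N) : ℝ := gauge (bodyΩ ω) x

/-- `p` is a momentum at `x`, that is, a normal to `ρ(x) Ω` at `x`:
`ρ(x)⁻¹ x = ∂H_Ω/∂p (p)`. -/
def IsMomentum {N : ℕ} (ω : Fin N → ℝ) (x p : Phase N) : Prop :=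
  p ≠ 0 ∧ HasGradientAt (supportΩ ω) ((rho ω x)⁻¹ • x) p

/-- `x` is a (Carathéodory) solution on `[0, T]` of `x' = A x + B u`, where `u` is an admissible
control, that is, measurable with `|u| ≤ 1`. -/
structure IsMotion {N : ℕ} (ω : Fin N → ℝ) (T : ℝ) (x : ℝ → Phase N) (u : ℝ → ℝ) : Prop where
  aemeasurable : AEMeasurable u (volume.restrict (Set.Icc 0 T))
  abs_le_one : ∀ᵐ t ∂volume.restrict (Set.Icc 0 T), |u t| ≤ 1
  continuousOn : ContinuousOn x (Set.Icc 0 T)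
  eq_integral : ∀ t ∈ Set.Icc 0 T,
    x t = x 0 + ∫ s in (0 : ℝ)..t,
      (Matrix.toEuclideanCLM (𝕜 := ℝ) (matA ω) (x s) + u s • vecB N)

/-- A motion under the feedback `u = -sign (B, p(x))`. The feedback is discontinuous, so `sign 0`
is any number in `[-1, 1]`: on `(B, p(x)) = 0` the control is only required to be admissible,
which allows the singular (sliding) motions. -/
structure IsFeedbackMotion {N : ℕ} (ω : Fin N → ℝ) (T : ℝ) (x : ℝ → Phase N) (u : ℝ → ℝ) : Prop
    extends IsMotion ω T x u where
  feedback : ∀ᵐ t ∂volume.restrict (Set.Icc 0 T), ∀ p : Phase N, IsMomentum ω (x t) p →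
    inner ℝ (vecB N) p ≠ 0 → u t = -Real.sign (inner ℝ (vecB N) p)

end Oscillators

end

/-!
Along the costate flow `p' = -A† p` the pairing `(x, p)` changes only through the control, at rate
`u (B, p)`, and `(B, p(t))` is a trigonometric wave on the torus sampled along the line `t ↦ ω t`.
Non-resonance (Weyl equidistribution, uniformly on compact sets of waves) makes the time average of
`|(B, p(t))|` over long intervals equal to its torus average, which is the support function `H p`,
a norm invariant under the flow. Since `ρ(x)` is the maximum of `(x, p)` over `H p ≤ 1`, following
the costate that is extremal at the start shows that no control lowers `ρ` faster than at unit rate.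

Under the feedback, follow backwards the costate that is extremal at the end of a window of bounded
length. As `ρ` varies at bounded speed, far from the origin this costate `p` stays almost extremal,
so for the momentum `q` that defines the feedback, both normalized by `H p = H q = 1`, the value
`H (p + q)` is nearly `H p + H q`. When these are equal, the waves of `p` and `q` have the same sign
everywhere, hence so do `(B, p)` and `(B, q)`; by compactness this persists approximately when
`(B, p)` is not small. So `u (B, p)` is nearly `-|(B, p)|`, and `ρ` drops at nearly unit rate on
each window.
-/

noncomputable section

namespace Oscillators

open Filter Topology Pointwise

section Torus

variable {ι : Type*}

/-- The quotient map `ℝ^ι → (ℝ / 2π)^ι`, with values in Mathlib's torus of period `1`. -/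
def toTorus : (ι → ℝ) →+ UnitAddTorus ι where
  toFun φ i := ((φ i / (2 * Real.pi) : ℝ) : UnitAddCircle)
  map_zero' := by ext i; simp
  map_add' φ ψ := by ext i; simp [add_div]

lemma toTorus_apply (φ : ι → ℝ) (i : ι) :
    toTorus φ i = ((φ i / (2 * Real.pi) : ℝ) : UnitAddCircle) := rfl

lemma continuous_toTorus : Continuous (toTorus : (ι → ℝ) → UnitAddTorus ι) :=
  continuous_pi fun i => (AddCircle.continuous_mk' 1).comp <| by fun_prop

lemma continuous_add_toTorus_smul (x : UnitAddTorus ι) (ω : ι → ℝ) :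
    Continuous fun t : ℝ => x + toTorus (t • ω) :=
  continuous_const.add (continuous_toTorus.comp (by fun_prop))

lemma fourier_toTorus (n : ℤ) (φ : ι → ℝ) (i : ι) :
    fourier n (toTorus φ i) = Complex.exp ((n * φ i : ℝ) * Complex.I) := by
  rw [toTorus_apply, fourier_coe_apply]
  congr 1
  push_cast
  field_simp

variable [Fintype ι]

lemma mFourier_add_apply (n : ι → ℤ) (x y : UnitAddTorus ι) :
    UnitAddTorus.mFourier n (x + y) = UnitAddTorus.mFourier n x * UnitAddTorus.mFourier n y := by
  simp [UnitAddTorus.mFourier, Finset.prod_mul_distrib, AddCircle.toCircle_add]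

lemma mFourier_toTorus (n : ι → ℤ) (φ : ι → ℝ) :
    UnitAddTorus.mFourier n (toTorus φ) = Complex.exp ((∑ i, n i * φ i : ℝ) * Complex.I) := by
  simp only [UnitAddTorus.mFourier, ContinuousMap.coe_mk, fourier_toTorus, ← Complex.exp_sum,
    ← Finset.sum_mul]
  push_cast
  rfl

instance : IsProbabilityMeasure (volume : Measure UnitAddCircle) :=
  ⟨UnitAddCircle.measure_univ⟩

theorem integral_torus_eq {E : Type*} [NormedAddCommGroup E] [NormedSpace ℝ E]
    {f : UnitAddTorus ι → E} (hf : AEStronglyMeasurable f) :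
    ∫ x, f x = ((2 * Real.pi) ^ Fintype.card ι)⁻¹ •
      ∫ φ in Set.Icc (fun _ : ι => (0 : ℝ)) fun _ => 2 * Real.pi, f (toTorus φ) := by
  have hmk : MeasurePreserving (fun (y : ι → ℝ) i => (y i : UnitAddCircle))
      (volume.restrict (Set.Icc 0 1)) volume := by
    have h := measurePreserving_pi _ _ fun _ : ι => UnitAddCircle.measurePreserving_mk 0
    rw [volume_pi, ← Measure.restrict_congr_set Measure.univ_pi_Ioc_ae_eq_Icc]
    simpa [Measure.restrict_pi_pi] using! h
  have hbox : (2 * Real.pi) • Set.Icc (0 : ι → ℝ) 1 =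
      Set.Icc (fun _ => 0) fun _ => 2 * Real.pi := by
    ext φ
    simp only [Set.mem_smul_set_iff_inv_smul_mem₀ Real.two_pi_pos.ne', Set.mem_Icc, Pi.le_def,
      Pi.smul_apply, smul_eq_mul, Pi.zero_apply, Pi.one_apply, inv_mul_le_iff₀ Real.two_pi_pos,
      le_inv_mul_iff₀ Real.two_pi_pos, mul_zero, mul_one]
  rw [← hbox, ← Module.finrank_fintype_fun_eq_card (R := ℝ),
    ← Measure.setIntegral_comp_smul_of_pos _ _ _ Real.two_pi_pos, ← hmk.map_eq, integral_map
      hmk.measurable.aemeasurable (by rwa [hmk.map_eq])]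
  congr with y
  congr with i
  simp [toTorus_apply, Real.pi_ne_zero]

lemma integral_mFourier {n : ι → ℤ} (hn : n ≠ 0) : ∫ x, UnitAddTorus.mFourier n x = 0 := by
  classical
  obtain ⟨i, hi⟩ : ∃ i, n i ≠ 0 := Function.ne_iff.1 hn
  have hi' : (n i : ℝ) ≠ 0 := by exact_mod_cast hi
  have hneg : UnitAddTorus.mFourier n (toTorus (Pi.single i (Real.pi / n i))) = -1 := by
    rw [mFourier_toTorus, Finset.sum_eq_single i (by intro j _ hj; simp [hj]) (by simp),
      Pi.single_eq_same, mul_div_cancel₀ _ hi', Complex.exp_pi_mul_I]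
  have h := integral_add_right_eq_self (μ := volume) (UnitAddTorus.mFourier n)
    (toTorus (Pi.single i (Real.pi / n i)))
  simp only [mFourier_add_apply, hneg, mul_neg_one, integral_neg] at h
  exact self_eq_neg.1 h.symm

lemma tendsto_interval_average_exp {c : ℝ} (hc : c ≠ 0) :
    Tendsto (fun T : ℝ => ⨍ t in 0..T, Complex.exp ((t * c : ℝ) * Complex.I)) atTop (𝓝 0) := by
  have hc' : (c * Complex.I : ℂ) ≠ 0 := by simp [hc]
  refine squeeze_zero_norm' (a := fun T => T⁻¹ * (2 / |c|)) ?_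
    (by simpa using tendsto_inv_atTop_zero.mul_const (2 / |c|))
  filter_upwards [eventually_ge_atTop 0] with T hT
  have hint : ∫ t in (0 : ℝ)..T, Complex.exp ((t * c : ℝ) * Complex.I) =
      (Complex.exp ((T * c : ℝ) * Complex.I) - 1) / (c * Complex.I) := by
    have := integral_exp_mul_complex (a := 0) (b := T) hc'
    simpa [mul_comm, mul_left_comm, mul_assoc] using this
  rw [interval_average_eq, hint, sub_zero, norm_smul, norm_div, Real.norm_of_nonneg (by positivity),
    norm_mul, Complex.norm_I, mul_one, Complex.norm_real, Real.norm_eq_abs]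
  gcongr
  exact (norm_sub_le _ _).trans (by rw [Complex.norm_exp_ofReal_mul_I]; norm_num)

end Torus

section Weyl

lemma integrable_continuousMap {X E : Type*} [TopologicalSpace X] [CompactSpace X]
    [MeasurableSpace X] [OpensMeasurableSpace X] [NormedAddCommGroup E]
    [SecondCountableTopologyEither X E] {μ : Measure X} [IsFiniteMeasureOnCompacts μ]
    (f : C(X, E)) : Integrable f μ :=
  f.continuous.integrable_of_hasCompactSupport (.of_compactSpace _)

lemma continuous_integral_continuousMap {X E : Type*} [TopologicalSpace X] [CompactSpace X]
    [MeasurableSpace X] [BorelSpace X] [NormedAddCommGroup E] [NormedSpace ℝ E]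
    [SecondCountableTopologyEither X E] (μ : Measure X) [IsFiniteMeasure μ] :
    Continuous fun f : C(X, E) => ∫ x, f x ∂μ :=
  (continuous_integral.comp (ContinuousMap.toLp 1 μ ℝ).continuous).congr fun f =>
    integral_congr_ae (ContinuousMap.coeFn_toLp μ f)

lemma norm_interval_average_le {E : Type*} [NormedAddCommGroup E] [NormedSpace ℝ E] {f : ℝ → E}
    {C : ℝ} (hf : ∀ t, ‖f t‖ ≤ C) (a b : ℝ) : ‖⨍ t in a..b, f t‖ ≤ C := by
  have hC : 0 ≤ C := (norm_nonneg _).trans (hf a)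
  have h := intervalIntegral.norm_integral_le_of_norm_le_const fun t (_ : t ∈ Set.uIoc a b) => hf t
  rw [interval_average_eq, norm_smul, norm_inv, Real.norm_eq_abs]
  exact inv_mul_le_of_le_mul₀ (abs_nonneg _) hC (by rwa [mul_comm])

lemma lipschitzWith_interval_average_torus {ι E : Type*} [NormedAddCommGroup E]
    [NormedSpace ℝ E] (ω : ι → ℝ) (x : UnitAddTorus ι) (T : ℝ) :
    LipschitzWith 1 fun F : C(UnitAddTorus ι, E) => ⨍ t in 0..T, F (x + toTorus (t • ω)) := by
  have hint : ∀ F : C(UnitAddTorus ι, E),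
      IntervalIntegrable (fun t => F (x + toTorus (t • ω))) volume 0 T := fun F =>
    (F.continuous.comp (continuous_add_toTorus_smul x ω)).intervalIntegrable 0 T
  refine LipschitzWith.mk_one fun F G => ?_
  rw [dist_eq_norm, dist_eq_norm, interval_average_eq, interval_average_eq, ← smul_sub,
    ← intervalIntegral.integral_sub (hint F) (hint G), ← interval_average_eq]
  exact norm_interval_average_le (fun t => (F - G).norm_coe_le_norm _) _ _

variable {ι : Type*} [Fintype ι] {ω : ι → ℝ}

lemma tendsto_interval_average_mFourier (hω : ∀ m : ι → ℤ, ∑ i, m i * ω i = 0 → m = 0)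
    (x : UnitAddTorus ι) (n : ι → ℤ) :
    Tendsto (fun T : ℝ => ⨍ t in 0..T, UnitAddTorus.mFourier n (x + toTorus (t • ω))) atTop
      (𝓝 (∫ y, UnitAddTorus.mFourier n y)) := by
  by_cases hn : n = 0
  · refine tendsto_const_nhds.congr' ?_
    filter_upwards [eventually_gt_atTop 0] with T hT
    simp [hn, UnitAddTorus.mFourier_zero, interval_average_eq, hT.ne']
  · have hexp : ∀ t : ℝ, UnitAddTorus.mFourier n (x + toTorus (t • ω)) =
        UnitAddTorus.mFourier n x * Complex.exp ((t * ∑ i, n i * ω i : ℝ) * Complex.I) := by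
      intro t
      simp only [mFourier_add_apply, mFourier_toTorus, Pi.smul_apply, smul_eq_mul, Finset.mul_sum,
        mul_left_comm]
    have h := (tendsto_interval_average_exp (mt (hω n) hn)).const_mul (UnitAddTorus.mFourier n x)
    simpa only [hexp, integral_mFourier hn, interval_average_eq,
      intervalIntegral.integral_const_mul, mul_smul_comm, mul_zero] using h

theorem tendsto_interval_average_torus_complex (hω : ∀ m : ι → ℤ, ∑ i, m i * ω i = 0 → m = 0)
    (x : UnitAddTorus ι) (F : C(UnitAddTorus ι, ℂ)) :
    Tendsto (fun T : ℝ => ⨍ t in 0..T, F (x + toTorus (t • ω))) atTop (𝓝 (∫ y, F y)) := by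
  let S : Set C(UnitAddTorus ι, ℂ) :=
    {G | Tendsto (fun T : ℝ => ⨍ t in 0..T, G (x + toTorus (t • ω))) atTop (𝓝 (∫ y, G y))}
  have hint : ∀ (G : C(UnitAddTorus ι, ℂ)) a b,
      IntervalIntegrable (fun t => G (x + toTorus (t • ω))) volume a b := fun G a b =>
    (G.continuous.comp (continuous_add_toTorus_smul x ω)).intervalIntegrable a b
  have hclosed : IsClosed S :=
    (LipschitzWith.uniformEquicontinuous _ 1
      (lipschitzWith_interval_average_torus ω x)).equicontinuous.isClosed_setOfPred_tendsto
      (continuous_integral_continuousMap volume)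
  have hspan : (Submodule.span ℂ (Set.range (UnitAddTorus.mFourier (d := ι))) : Set _) ⊆ S := by
    intro G hG
    induction hG using Submodule.span_induction with
    | mem G hG => obtain ⟨n, rfl⟩ := hG; exact tendsto_interval_average_mFourier hω x n
    | zero => simp [S, interval_average_eq]
    | add G H _ _ hG hH =>
      simpa [S, interval_average_eq, intervalIntegral.integral_add (hint G _ _) (hint H _ _),
        mul_add, integral_add (integrable_continuousMap G)
        (integrable_continuousMap H)] using hG.add hH
    | smul c G _ hG =>
      simpa [S, interval_average_eq, integral_const_mul, mul_left_comm] using hG.const_mul c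
  refine hclosed.closure_subset_iff.2 hspan ?_
  rw [← Submodule.topologicalClosure_coe, UnitAddTorus.span_mFourier_closure_eq_top]
  trivial

theorem tendsto_interval_average_torus (hω : ∀ m : ι → ℤ, ∑ i, m i * ω i = 0 → m = 0)
    (x : UnitAddTorus ι) (F : C(UnitAddTorus ι, ℝ)) :
    Tendsto (fun T : ℝ => ⨍ t in 0..T, F (x + toTorus (t • ω))) atTop (𝓝 (∫ y, F y)) := by
  have h := (Complex.continuous_re.tendsto _).comp <| tendsto_interval_average_torus_complex hω x
    ⟨fun y => (F y : ℂ), Complex.continuous_ofReal.comp F.continuous⟩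
  simpa [Function.comp_def, interval_average_eq, intervalIntegral.integral_ofReal,
    integral_complex_ofReal] using h

theorem tendstoUniformlyOn_interval_average_torus
    (hω : ∀ m : ι → ℤ, ∑ i, m i * ω i = 0 → m = 0) (x : UnitAddTorus ι)
    {K : Set C(UnitAddTorus ι, ℝ)} (hK : IsCompact K) :
    TendstoUniformlyOn (fun (T : ℝ) F => ⨍ t in 0..T, F (x + toTorus (t • ω)))
      (fun F => ∫ y, F y) atTop K := by
  have hcont := (LipschitzWith.uniformEquicontinuous _ 1
    (lipschitzWith_interval_average_torus (E := ℝ) ω x)).equicontinuous.equicontinuousOn K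
  have h := (EquicontinuousOn.tendsto_uniformOnFun_iff_pi' (𝔖 := {K}) (by simpa) (by simpa) atTop
    fun F : C(UnitAddTorus ι, ℝ) => ∫ y, F y).2 <| tendsto_pi_nhds.2 fun F =>
      tendsto_interval_average_torus hω x F
  exact UniformOnFun.tendsto_iff_tendstoUniformlyOn.1 h K rfl

end Weyl

section L1

variable {X : Type*} [TopologicalSpace X] [CompactSpace X] [MeasurableSpace X] [BorelSpace X]
  {μ : Measure X} [IsFiniteMeasure μ]

/-- The seminorm `f ↦ ∫ |f| dμ` on the continuous functions on a compact space. -/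
def l1Seminorm (μ : Measure X) [IsFiniteMeasure μ] : Seminorm ℝ C(X, ℝ) :=
  (normSeminorm ℝ (Lp ℝ 1 μ)).comp (ContinuousMap.toLp 1 μ ℝ).toLinearMap

lemma l1Seminorm_apply (f : C(X, ℝ)) : l1Seminorm μ f = ∫ x, |f x| ∂μ := by
  change ‖ContinuousMap.toLp 1 μ ℝ f‖ = _
  rw [L1.norm_eq_integral_norm]
  exact integral_congr_ae ((ContinuousMap.coeFn_toLp μ f).fun_comp norm)

lemma l1Seminorm_eq_zero_iff [μ.IsOpenPosMeasure] {f : C(X, ℝ)} : l1Seminorm μ f = 0 ↔ f = 0 := by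
  change ‖ContinuousMap.toLp 1 μ ℝ f‖ = 0 ↔ _
  rw [norm_eq_zero, map_eq_zero_iff _ (ContinuousMap.toLp_injective μ)]

theorem mul_nonneg_of_l1Seminorm_add [μ.IsOpenPosMeasure] {f g : C(X, ℝ)}
    (h : l1Seminorm μ (f + g) = l1Seminorm μ f + l1Seminorm μ g) (x : X) : 0 ≤ f x * g x := by
  have hdefect : l1Seminorm μ (|f| + |g| - |f + g|) = 0 := by
    have hnonneg : ∀ y, |(|f| + |g| - |f + g|) y| = |f y| + |g y| - |(f + g) y| := fun y =>
      abs_of_nonneg (sub_nonneg.2 (abs_add_le (f y) (g y)))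
    rw [l1Seminorm_apply, integral_congr_ae (.of_forall hnonneg), integral_sub, integral_add,
      ← l1Seminorm_apply, ← l1Seminorm_apply, ← l1Seminorm_apply, h, sub_self]
    exacts [integrable_continuousMap |f|, integrable_continuousMap |g|,
      integrable_continuousMap (|f| + |g|), integrable_continuousMap |f + g|]
  have hx := DFunLike.congr_fun (l1Seminorm_eq_zero_iff.1 hdefect) x
  have hadd : |f x + g x| = |f x| + |g x| := (sub_eq_zero.1 hx).symm
  rcases (abs_add_eq_add_abs_iff _ _).1 hadd with ⟨hf, hg⟩ | ⟨hf, hg⟩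
  exacts [mul_nonneg hf hg, mul_nonneg_of_nonpos_of_nonpos hf hg]

theorem differentiableAt_l1Seminorm_comp {E : Type*} [NormedAddCommGroup E] [NormedSpace ℝ E]
    [FiniteDimensional ℝ E] (W : E →L[ℝ] C(X, ℝ)) {p : E} (hp : ∀ᵐ x ∂μ, W p x ≠ 0) :
    DifferentiableAt ℝ (fun q => l1Seminorm μ (W q)) p := by
  let W' (x : X) : E →L[ℝ] ℝ := (ContinuousMap.evalCLM ℝ x).comp W
  have hW' : Continuous W' := continuous_clm_apply.2 fun q => (W q).continuous
  have hsign : Measurable fun x => deriv (fun s : ℝ => |s|) (W p x) :=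
    (measurable_deriv _).comp (W p).continuous.measurable
  have habs : ∀ x, W p x ≠ 0 →
      HasFDerivAt (fun q => |W q x|) (deriv (fun s : ℝ => |s|) (W p x) • W' x) p := fun x hx =>
    HasDerivAt.comp_hasFDerivAt (h₂ := fun s : ℝ => |s|) p (differentiableAt_abs hx).hasDerivAt
      (W' x).hasFDerivAt
  have h := hasFDerivAt_integral_of_dominated_loc_of_lip (𝕜 := ℝ) (μ := μ) (x₀ := p)
    (s := Set.univ) (F := fun q x => |W q x|) (bound := fun _ => ‖W‖) univ_mem
    (.of_forall fun q => (integrable_continuousMap |W q|).aestronglyMeasurable)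
    (integrable_continuousMap |W p|)
    (hsign.aestronglyMeasurable.smul hW'.aestronglyMeasurable)
    (.of_forall fun x => .of_dist_le_mul fun q _ r _ => ?_)
    (integrable_const _) (hp.mono habs)
  · simpa only [l1Seminorm_apply] using h.2.differentiableAt
  · rw [Real.coe_nnabs, dist_eq_norm, dist_eq_norm]
    calc |‖W q x‖ - ‖W r x‖|
      _ ≤ ‖W (q - r) x‖ := by rw [map_sub]; exact abs_norm_sub_norm_le (W q x) (W r x)
      _ ≤ ‖W (q - r)‖ := (W (q - r)).norm_coe_le_norm x
      _ ≤ ‖W‖ * ‖q - r‖ := W.le_opNorm _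
      _ ≤ |‖W‖| * ‖q - r‖ := by gcongr; exact le_abs_self _

end L1

section Wave

variable {ι : Type*} [Fintype ι]

/-- The function `φ ↦ ∑ i, Re (c i * exp (I φ i))` on the torus: the signal seen by the control
when the oscillators have complex amplitudes `c i` and phases `φ i`. -/
def wave : (ι → ℂ) →ₗ[ℝ] C(UnitAddTorus ι, ℝ) where
  toFun c := ⟨fun x => ∑ i, (c i * fourier 1 (x i)).re, by fun_prop⟩
  map_add' c d := by ext x; simp [add_mul, Finset.sum_add_distrib]
  map_smul' r c := by ext x; simp [Finset.mul_sum, mul_sub, mul_assoc]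

lemma wave_apply (c : ι → ℂ) (x : UnitAddTorus ι) :
    wave c x = ∑ i, (c i * fourier 1 (x i)).re := rfl

lemma wave_add_toTorus (c : ι → ℂ) (x : UnitAddTorus ι) (φ : ι → ℝ) :
    wave c (x + toTorus φ) = wave (fun i => c i * Complex.exp (φ i * Complex.I)) x := by
  have h : ∀ i, fourier 1 ((x + toTorus φ) i) =
      Complex.exp (φ i * Complex.I) * fourier 1 (x i) := fun i => by
    rw [Pi.add_apply, fourier_one, AddCircle.toCircle_add, Circle.coe_mul, ← fourier_one,
      ← fourier_one, fourier_toTorus, mul_comm]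
    simp
  simp only [wave_apply, h, mul_assoc]

lemma l1Seminorm_wave_mul_exp (c : ι → ℂ) (φ : ι → ℝ) :
    l1Seminorm volume (wave fun i => c i * Complex.exp (φ i * Complex.I)) =
      l1Seminorm volume (wave c) := by
  simp only [l1Seminorm_apply, ← wave_add_toTorus]
  exact integral_add_right_eq_self (fun x => |wave c x|) (toTorus φ)

/-- Rotating all phases to `0` is a translation of the torus. -/
lemma l1Seminorm_wave_eq_norm (c : ι → ℂ) :
    l1Seminorm volume (wave c) = l1Seminorm volume (wave fun i => (‖c i‖ : ℂ)) := by
  conv_lhs => rw [← funext fun i => Complex.norm_mul_exp_arg_mul_I (c i)]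
  exact l1Seminorm_wave_mul_exp _ _

theorem l1Seminorm_wave_eq_box (c : ι → ℂ) :
    l1Seminorm volume (wave c) = ((2 * Real.pi) ^ Fintype.card ι)⁻¹ *
      ∫ φ in Set.Icc (fun _ : ι => (0 : ℝ)) fun _ => 2 * Real.pi,
        |∑ i, ‖c i‖ * Real.cos (φ i)| := by
  have hcos : ∀ φ : ι → ℝ, wave (fun i => (‖c i‖ : ℂ)) (toTorus φ) =
      ∑ i, ‖c i‖ * Real.cos (φ i) := by
    intro φ
    simp only [wave_apply, fourier_toTorus, Int.cast_one, one_mul, Complex.re_ofReal_mul,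
      Complex.exp_ofReal_mul_I_re]
  rw [l1Seminorm_wave_eq_norm, l1Seminorm_apply,
    integral_torus_eq (wave _).continuous.abs.aestronglyMeasurable]
  simp only [hcos, smul_eq_mul]

lemma re_nonpos_of_eventually_nonneg {z : ℂ}
    (h : ∀ᶠ s : ℝ in 𝓝 0, 0 ≤ (z * (Complex.exp (s * Complex.I) - 1)).re) :
    z.re ≤ 0 ∧ (z.re = 0 → z.im = 0) := by
  have hneg := (continuous_neg.tendsto' (0 : ℝ) 0 neg_zero).eventually h
  obtain ⟨s, ⟨hs, hs'⟩, hs0, hsπ⟩ := (((h.and hneg).filter_mono nhdsWithin_le_nhds).and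
    (Ioo_mem_nhdsGT Real.pi_pos)).exists
  have hsin := Real.sin_pos_of_pos_of_lt_pi hs0 hsπ
  have hcos : Real.cos s < 1 := by nlinarith [Real.sin_sq_add_cos_sq s]
  simp only [Complex.mul_re, Complex.sub_re, Complex.sub_im, Complex.exp_ofReal_mul_I_re,
    Complex.exp_ofReal_mul_I_im, Complex.one_re, Complex.one_im, sub_zero, Real.cos_neg,
    Real.sin_neg] at hs hs'
  refine ⟨by nlinarith, fun h0 => ?_⟩
  rw [h0] at hs hs'
  nlinarith

lemma wave_add_toTorus_single [DecidableEq ι] (c : ι → ℂ) (x : UnitAddTorus ι) (i : ι) (s : ℝ) :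
    wave c (x + toTorus (Pi.single i s)) =
      wave c x + (c i * fourier 1 (x i) * (Complex.exp (s * Complex.I) - 1)).re := by
  have hterm : ∀ j, (c j * Complex.exp ((Pi.single i s : ι → ℝ) j * Complex.I) *
      fourier 1 (x j)).re = (c j * fourier 1 (x j)).re +
        if j = i then (c j * fourier 1 (x j) * (Complex.exp (s * Complex.I) - 1)).re else 0 := by
    intro j
    split_ifs with hj
    · subst hj
      rw [Pi.single_eq_same, ← Complex.add_re]
      congr 1
      ring
    · simp [Pi.single_eq_of_ne hj]
  rw [wave_add_toTorus]
  simp only [wave_apply, hterm, Finset.sum_add_distrib, Finset.sum_ite_eq', Finset.mem_univ,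
    if_true]

/-- Since a wave is harmonic in each phase, a local minimum forces each single oscillation to have
nonpositive real part there. -/
theorem eq_zero_of_wave_nonneg {c : ι → ℂ} {x : UnitAddTorus ι} (h0 : wave c x = 0)
    (h : ∀ᶠ y in 𝓝 x, 0 ≤ wave c y) : c = 0 := by
  classical
  have hloc : ∀ i, (c i * fourier 1 (x i)).re ≤ 0 ∧
      ((c i * fourier 1 (x i)).re = 0 → (c i * fourier 1 (x i)).im = 0) := by
    intro i
    have hcont : Continuous fun s : ℝ => x + toTorus (Pi.single i s) :=
      continuous_const.add (continuous_toTorus.comp (continuous_single (A := fun _ => ℝ) i))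
    refine re_nonpos_of_eventually_nonneg ?_
    filter_upwards [(hcont.tendsto' 0 x (by simp)).eventually h] with s hs
    rwa [wave_add_toTorus_single, h0, zero_add] at hs
  have hre := (Finset.sum_eq_zero_iff_of_nonpos fun i _ => (hloc i).1).1 h0
  funext i
  have hi := hre i (Finset.mem_univ i)
  have hmul : c i * fourier 1 (x i) = 0 := Complex.ext hi ((hloc i).2 hi)
  simpa using hmul

lemma ae_of_ae_add_curve {G : Type*} [AddCommGroup G] [MeasurableSpace G] [MeasurableAdd₂ G]
    {μ : Measure G} [SFinite μ] [μ.IsAddRightInvariant] {γ : ℝ → G} (hγ : Measurable γ)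
    {P : G → Prop} (hP : MeasurableSet {x | P x}) (h : ∀ x, ∀ᵐ t : ℝ, P (x + γ t)) :
    ∀ᵐ x ∂μ, P x := by
  have hmeas : MeasurableSet {z : G × ℝ | P (z.1 + γ z.2)} :=
    (measurable_fst.add (hγ.comp measurable_snd)) hP
  obtain ⟨t, ht⟩ := ((Measure.ae_ae_comm (μ := μ) hmeas).1 (.of_forall h)).exists
  rw [← map_add_right_eq_self μ (γ t)]
  exact (ae_map_iff (measurable_add_const _).aemeasurable hP).2 ht

lemma ae_re_mul_exp_ne {d : ℂ} (hd : d ≠ 0) (a : ℝ) :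
    ∀ᵐ t : ℝ, (d * Complex.exp (t * Complex.I)).re ≠ a := by
  simp only [Complex.mul_re, Complex.exp_ofReal_mul_I_re, Complex.exp_ofReal_mul_I_im]
  let g : ℝ → ℝ := fun t => d.re * Real.cos t - d.im * Real.sin t - a
  have hg : AnalyticOnNhd ℝ g Set.univ := fun t _ => by fun_prop
  obtain ⟨t₀, ht₀⟩ : ∃ t, g t ≠ 0 := by
    by_contra! h
    have h0 := h 0
    have hπ := h Real.pi
    have hπ2 := h (Real.pi / 2)
    simp only [g, Real.cos_zero, Real.sin_zero, Real.cos_pi, Real.sin_pi, Real.cos_pi_div_two,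
      Real.sin_pi_div_two] at h0 hπ hπ2
    exact hd (Complex.ext (by rw [Complex.zero_re]; linarith) (by rw [Complex.zero_im]; linarith))
  have hae := ae_restrict_le_codiscreteWithin (μ := volume) MeasurableSet.univ
    (hg.preimage_zero_mem_codiscrete ht₀)
  rw [Measure.restrict_univ] at hae
  filter_upwards [hae] with t ht using sub_ne_zero.1 ht

lemma ae_wave_ne_zero {c : ι → ℂ} (hc : c ≠ 0) : ∀ᵐ x, wave c x ≠ 0 := by
  classical
  obtain ⟨i, hi⟩ : ∃ i, c i ≠ 0 := Function.ne_iff.1 hc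
  refine ae_of_ae_add_curve (γ := fun t => toTorus (Pi.single i t))
    (continuous_toTorus.comp (continuous_single (A := fun _ => ℝ) i)).measurable
    ((wave c).continuous.measurable (measurableSet_singleton 0).compl) fun x => ?_
  have hd : c i * fourier 1 (x i) ≠ 0 := mul_ne_zero hi (by simp)
  filter_upwards [ae_re_mul_exp_ne hd ((c i * fourier 1 (x i)).re - wave c x)] with t ht h
  rw [wave_add_toTorus_single, mul_sub_one, Complex.sub_re] at h
  exact ht (by linarith)

lemma l1Seminorm_wave_pos {c : ι → ℂ} (hc : c ≠ 0) : 0 < l1Seminorm volume (wave c) := by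
  refine (apply_nonneg _ _).lt_of_ne' fun h => hc ?_
  have h0 : wave c = 0 := l1Seminorm_eq_zero_iff.1 h
  exact eq_zero_of_wave_nonneg (x := 0) (by simp [h0]) (.of_forall fun y => by simp [h0])

end Wave

section Polar

variable {E : Type*} [NormedAddCommGroup E] [InnerProductSpace ℝ E]

/-- The polar body of a seminorm `H`: the closed convex set with support function `H`. -/
def polarBody (H : Seminorm ℝ E) : Set E := {x | ∀ p, inner ℝ x p ≤ H p}

lemma convex_polarBody (H : Seminorm ℝ E) : Convex ℝ (polarBody H) := by
  rw [polarBody, Set.ofPred_forall]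
  exact convex_iInter fun p => convex_halfSpace_le
    (((innerSL ℝ).flip p).isBoundedLinearMap.toIsLinearMap) (H p)

variable [FiniteDimensional ℝ E]

lemma continuous_seminorm (H : Seminorm ℝ E) : Continuous H :=
  continuousOn_univ.1 (H.convexOn.continuousOn isOpen_univ)

variable {H : Seminorm ℝ E}

lemma exists_pos_mul_norm_le_seminorm (hH : ∀ p, p ≠ 0 → 0 < H p) :
    ∃ c > 0, ∀ p, c * ‖p‖ ≤ H p := by
  obtain ⟨c, hc, hle⟩ := (isCompact_sphere (0 : E) 1).exists_forall_le'
    (continuous_seminorm H).continuousOn (a := 0)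
    fun p hp => hH p (ne_zero_of_mem_unit_sphere ⟨p, hp⟩)
  refine ⟨c, hc, fun p => ?_⟩
  obtain rfl | hp := eq_or_ne p 0
  · simp
  · have hunit := hle (‖p‖⁻¹ • p) (by simp [norm_smul, hp])
    rwa [map_smul_eq_mul, norm_inv, norm_norm, ← div_eq_inv_mul, le_div_iff₀ (norm_pos_iff.2 hp)]
      at hunit

lemma isCompact_seminorm_le_one (hH : ∀ p, p ≠ 0 → 0 < H p) : IsCompact {p | H p ≤ 1} := by
  obtain ⟨c, hc, hle⟩ := exists_pos_mul_norm_le_seminorm hH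
  refine Metric.isCompact_of_isClosed_isBounded
    (isClosed_le (continuous_seminorm H) continuous_const)
    ((Metric.isBounded_closedBall (x := (0 : E)) (r := c⁻¹)).subset fun p hp => ?_)
  rw [mem_closedBall_zero_iff, ← one_div, le_div_iff₀' hc]
  exact (hle p).trans hp

lemma polarBody_mem_nhds_zero (hH : ∀ p, p ≠ 0 → 0 < H p) : polarBody H ∈ 𝓝 0 := by
  obtain ⟨c, hc, hle⟩ := exists_pos_mul_norm_le_seminorm hH
  filter_upwards [Metric.ball_mem_nhds 0 hc] with x hx p
  rw [mem_ball_zero_iff] at hx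
  calc inner ℝ x p ≤ ‖x‖ * ‖p‖ := real_inner_le_norm x p
    _ ≤ c * ‖p‖ := by gcongr
    _ ≤ H p := hle p

lemma gauge_polarBody_le_iff (hH : ∀ p, p ≠ 0 → 0 < H p) {x : E} {r : ℝ} (hr : 0 ≤ r) :
    gauge (polarBody H) x ≤ r ↔ ∀ p, inner ℝ x p ≤ r * H p := by
  have hmem : ∀ s : ℝ, 0 < s → (x ∈ s • polarBody H ↔ ∀ p, inner ℝ x p ≤ s * H p) := fun s hs => by
    simp only [Set.mem_smul_set_iff_inv_smul_mem₀ hs.ne', polarBody, Set.mem_ofPred_eq,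
      real_inner_smul_left, inv_mul_le_iff₀ hs]
  have hset := Set.ext_iff.1 (setOfPred_gauge_le_eq (convex_polarBody H)
    (by simp [polarBody]) (absorbent_nhds_zero (polarBody_mem_nhds_zero hH)) hr) x
  simp only [Set.mem_ofPred_eq, Set.mem_iInter] at hset
  refine hset.trans ⟨fun h p => ?_, fun h s hs => (hmem s (hr.trans_lt hs)).2 fun p => ?_⟩
  · refine ge_of_tendsto (f := fun s => s * H p) (x := 𝓝[>] r)
      ((continuous_id.mul continuous_const).continuousWithinAt) ?_
    filter_upwards [self_mem_nhdsWithin] with s hs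
    exact (hmem s (hr.trans_lt hs)).1 (h s hs) p
  · exact (h p).trans (mul_le_mul_of_nonneg_right hs.le (apply_nonneg H p))

lemma inner_le_gauge_polarBody_mul (hH : ∀ p, p ≠ 0 → 0 < H p) (x p : E) :
    inner ℝ x p ≤ gauge (polarBody H) x * H p :=
  (gauge_polarBody_le_iff hH (gauge_nonneg _)).1 le_rfl p

lemma exists_inner_eq_gauge_polarBody (hH : ∀ p, p ≠ 0 → 0 < H p) (x : E) :
    ∃ q, H q ≤ 1 ∧ inner ℝ x q = gauge (polarBody H) x := by
  obtain ⟨q, hq, hmax⟩ := (isCompact_seminorm_le_one hH).exists_isMaxOn ⟨0, by simp⟩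
    (f := fun p => inner ℝ x p) (by fun_prop)
  have hx : 0 ≤ inner ℝ x q := by simpa using hmax (a := 0) (by simp)
  refine ⟨q, hq, le_antisymm ?_ ((gauge_polarBody_le_iff hH hx).2 fun p => ?_)⟩
  · exact (inner_le_gauge_polarBody_mul hH x q).trans (mul_le_of_le_one_right (gauge_nonneg _) hq)
  obtain rfl | hp := eq_or_ne p 0
  · simp
  · have hunit : H ((H p)⁻¹ • p) ≤ 1 := by
      rw [map_smul_eq_mul, norm_inv, Real.norm_of_nonneg (apply_nonneg H p)]
      exact inv_mul_le_one
    have hle : inner ℝ x ((H p)⁻¹ • p) ≤ inner ℝ x q := hmax hunit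
    rwa [real_inner_smul_right, inv_mul_le_iff₀ (hH p hp), mul_comm] at hle

lemma eq_one_of_inner_eq_gauge_polarBody (hH : ∀ p, p ≠ 0 → 0 < H p) {x q : E}
    (hx : 0 < gauge (polarBody H) x) (hq : H q ≤ 1) (h : inner ℝ x q = gauge (polarBody H) x) :
    H q = 1 :=
  hq.antisymm <| le_of_mul_le_mul_left
    (by simpa only [mul_one, h] using inner_le_gauge_polarBody_mul hH x q) hx

theorem hasGradientAt_of_inner_eq_gauge_polarBody (hH : ∀ p, p ≠ 0 → 0 < H p) {x q : E}
    (hd : DifferentiableAt ℝ H q) (hx : 0 < gauge (polarBody H) x) (hq : H q ≤ 1)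
    (h : inner ℝ x q = gauge (polarBody H) x) :
    HasGradientAt H ((gauge (polarBody H) x)⁻¹ • x) q := by
  set r := gauge (polarBody H) x
  let ℓ : E →L[ℝ] ℝ := innerSL ℝ (r⁻¹ • x)
  have hℓ : ∀ p, ℓ p ≤ H p := fun p => by
    simpa [ℓ, real_inner_smul_left, inv_mul_le_iff₀ hx] using inner_le_gauge_polarBody_mul hH x p
  have hℓq : ℓ q = H q := by
    simp [ℓ, h, hx.ne', eq_one_of_inner_eq_gauge_polarBody hH hx hq h]
  have hmin : IsLocalMin (fun p => H p - ℓ p) q := .of_forall fun p => by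
    simpa only [hℓq, sub_self, sub_nonneg] using hℓ p
  have hzero := hmin.hasFDerivAt_eq_zero (hd.hasFDerivAt.sub ℓ.hasFDerivAt)
  rw [hasGradientAt_iff_hasFDerivAt]
  exact hd.hasFDerivAt.congr_fderiv (sub_eq_zero.1 hzero)

end Polar

section Pairing

variable {E : Type*} [NormedAddCommGroup E] [InnerProductSpace ℝ E]

lemma integral_mul_add_mul_deriv {f P P' : ℝ → ℝ} {a b : ℝ} (c : ℝ)
    (hf : IntervalIntegrable f volume a b) (hP : ∀ t, HasDerivAt P (P' t) t)
    (hP' : Continuous P') :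
    ∫ t in a..b, (f t * P t + (c + ∫ s in a..t, f s) * P' t) =
      (c + ∫ s in a..b, f s) * P b - c * P a := by
  have hderiv : deriv P = P' := funext fun t => (hP t).deriv
  have hprim : AbsolutelyContinuousOnInterval (fun t => c + ∫ s in a..t, f s) a b :=
    (contDiff_const (c := c)).contDiffOn.absolutelyContinuousOnInterval.add
      (hf.absolutelyContinuousOnInterval_intervalIntegral (by simp))
  have hPac : AbsolutelyContinuousOnInterval P a b :=
    (contDiff_one_iff_deriv.2 ⟨fun t => (hP t).differentiableAt,
      hderiv ▸ hP'⟩).contDiffOn.absolutelyContinuousOnInterval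
  have h := hprim.integral_deriv_mul_eq_sub hPac
  simp only [intervalIntegral.integral_same, add_zero] at h
  rw [← h]
  refine intervalIntegral.integral_congr_ae ?_
  filter_upwards [hf.ae_hasDerivAt_integral] with t ht hmem
  rw [((ht (Set.uIoc_subset_uIcc hmem) a (by simp)).const_add c).deriv, hderiv]

theorem integral_inner_add_inner_deriv [FiniteDimensional ℝ E] {g P P' : ℝ → E} {a b : ℝ} (c : E)
    (hg : IntervalIntegrable g volume a b) (hP : ∀ t, HasDerivAt P (P' t) t)
    (hP' : Continuous P') :
    ∫ t in a..b, (inner ℝ (g t) (P t) + inner ℝ (c + ∫ s in a..t, g s) (P' t)) =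
      inner ℝ (c + ∫ s in a..b, g s) (P b) - inner ℝ c (P a) := by
  let e := stdOrthonormalBasis ℝ E
  have hinner : ∀ v w : E, inner ℝ v w = ∑ k, inner ℝ (e k) v * inner ℝ (e k) w := fun v w => by
    simp only [← e.sum_inner_mul_inner v w, real_inner_comm v]
  have hgk : ∀ k, IntervalIntegrable (fun t => inner ℝ (e k) (g t)) volume a b := fun k =>
    ⟨hg.1.const_inner _, hg.2.const_inner _⟩
  have hPk : ∀ k t, HasDerivAt (fun t => inner ℝ (e k) (P t)) (inner ℝ (e k) (P' t)) t :=
    fun k t => (innerSL ℝ (e k)).hasFDerivAt.comp_hasDerivAt t (hP t)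
  have hP'k : ∀ k, Continuous fun t => inner ℝ (e k) (P' t) := fun k =>
    continuous_const.inner hP'
  have hprim : ∀ k, ∀ t ∈ Set.uIcc a b, inner ℝ (e k) (c + ∫ s in a..t, g s) =
      inner ℝ (e k) c + ∫ s in a..t, inner ℝ (e k) (g s) := fun k t ht => by
    rw [inner_add_right]
    exact congrArg _ ((innerSL ℝ (e k)).intervalIntegral_comp_comm
      (hg.mono_set (Set.uIcc_subset_uIcc_left ht))).symm
  calc _ = ∫ t in a..b, ∑ k, (inner ℝ (e k) (g t) * inner ℝ (e k) (P t) +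
        (inner ℝ (e k) c + ∫ s in a..t, inner ℝ (e k) (g s)) * inner ℝ (e k) (P' t)) := by
        refine intervalIntegral.integral_congr fun t ht => ?_
        simp only [hinner (g t), hinner (c + _), hprim _ t ht, Finset.sum_add_distrib]
    _ = ∑ k, ((inner ℝ (e k) c + ∫ s in a..b, inner ℝ (e k) (g s)) * inner ℝ (e k) (P b) -
        inner ℝ (e k) c * inner ℝ (e k) (P a)) := by
        rw [intervalIntegral.integral_finsetSum]
        · exact Finset.sum_congr rfl fun k _ =>
            integral_mul_add_mul_deriv _ (hgk k) (hPk k) (hP'k k)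
        · intro k _
          refine ((hgk k).mul_continuousOn
            (continuous_iff_continuousAt.2 fun t => (hPk k t).continuousAt).continuousOn).add
            (ContinuousOn.intervalIntegrable ?_)
          exact (continuousOn_const.add (intervalIntegral.continuousOn_primitive_interval'
            (hgk k) Set.left_mem_uIcc)).mul (hP'k k).continuousOn
    _ = _ := by
        rw [Finset.sum_sub_distrib, hinner (c + _), hinner c]
        simp only [hprim _ b Set.right_mem_uIcc]

variable [CompleteSpace E]

/-- The flow of the adjoint equation `p' = -A† p`. -/
def adjointFlow (A : E →L[ℝ] E) (t : ℝ) : E →L[ℝ] E := NormedSpace.exp (t • -A.adjoint)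

variable (A : E →L[ℝ] E)

lemma adjointFlow_zero (p : E) : adjointFlow A 0 p = p := by
  simp [adjointFlow]

lemma adjointFlow_add (s t : ℝ) (p : E) :
    adjointFlow A (s + t) p = adjointFlow A s (adjointFlow A t p) := by
  let _ := NormedAlgebra.restrictScalars ℚ ℝ (E →L[ℝ] E)
  rw [adjointFlow, add_smul, NormedSpace.exp_add_of_commute
    (((Commute.refl (-A.adjoint)).smul_left s).smul_right t)]
  rfl

lemma hasDerivAt_adjointFlow (p : E) (t : ℝ) :
    HasDerivAt (fun s => adjointFlow A s p) (-A.adjoint (adjointFlow A t p)) t :=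
  (hasDerivAt_exp_smul_const' (-A.adjoint) t).clm_apply (hasDerivAt_const t p) |>.congr_deriv
    (by simp [adjointFlow])

lemma continuous_adjointFlow (p : E) : Continuous fun t => adjointFlow A t p :=
  continuous_iff_continuousAt.2 fun t => (hasDerivAt_adjointFlow A p t).continuousAt

variable {A}

lemma map_adjointFlow_eq_exp_mul {ℓ : E →L[ℝ] ℂ} {ω : ℝ}
    (hℓ : ∀ q, ℓ (-A.adjoint q) = ω * Complex.I * ℓ q) (t : ℝ) (p : E) :
    ℓ (adjointFlow A t p) = ℓ p * Complex.exp (t * ω * Complex.I) := by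
  have hconst : ∀ s : ℝ,
      HasDerivAt (fun s : ℝ => Complex.exp (-(s * ω * Complex.I)) * ℓ (adjointFlow A s p)) 0 s := by
    intro s
    have hexp : HasDerivAt (fun s : ℝ => Complex.exp (-(s * ω * Complex.I)))
        (Complex.exp (-(s * ω * Complex.I)) * -(ω * Complex.I)) s := by
      simpa using (((Complex.ofRealCLM.hasDerivAt (x := s)).mul_const (ω : ℂ)).mul_const
        Complex.I).neg.cexp
    refine (hexp.mul (ℓ.hasFDerivAt.comp_hasDerivAt s
      (hasDerivAt_adjointFlow A p s))).congr_deriv ?_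
    rw [hℓ]
    simp only [Function.comp_apply]
    ring
  have h := is_const_of_deriv_eq_zero (fun s => (hconst s).differentiableAt)
    (fun s => (hconst s).deriv) t 0
  simp only [Complex.ofReal_zero, zero_mul, neg_zero, Complex.exp_zero, one_mul,
    adjointFlow_zero] at h
  rw [← h, mul_right_comm, ← Complex.exp_add, neg_add_cancel, Complex.exp_zero, one_mul]

/-- The pairing cancels the drift against its adjoint, so only the control contributes. -/
theorem inner_adjointFlow_sub_inner_adjointFlow [FiniteDimensional ℝ E] {x : ℝ → E} {u : ℝ → ℝ}
    {b : E} {s t : ℝ} (hx : ContinuousOn x (Set.uIcc s t)) (hu : IntervalIntegrable u volume s t)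
    (heq : ∀ r ∈ Set.uIcc s t, x r = x s + ∫ τ in s..r, (A (x τ) + u τ • b)) (p : E) :
    inner ℝ (x t) (adjointFlow A t p) - inner ℝ (x s) (adjointFlow A s p) =
      ∫ r in s..t, u r * inner ℝ b (adjointFlow A r p) := by
  have hg : IntervalIntegrable (fun τ => A (x τ) + u τ • b) volume s t :=
    (A.continuous.comp_continuousOn hx).intervalIntegrable.add
      ⟨hu.1.smul_const b, hu.2.smul_const b⟩
  have hP' : Continuous fun r => -A.adjoint (adjointFlow A r p) :=
    (A.adjoint.continuous.comp (continuous_adjointFlow A p)).neg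
  rw [heq t Set.right_mem_uIcc,
    ← integral_inner_add_inner_deriv _ hg (hasDerivAt_adjointFlow A p) hP']
  refine intervalIntegral.integral_congr fun r hr => ?_
  simp only [← heq r hr, inner_add_left, real_inner_smul_left, inner_neg_right,
    ContinuousLinearMap.adjoint_inner_right]
  ring

end Pairing

section Oscillator

variable {N : ℕ} (ω : Fin N → ℝ)

lemma NonResonant.ne_zero {ω : Fin N → ℝ} (hω : NonResonant ω) (i : Fin N) : ω i ≠ 0 := by
  intro h
  simpa using congrFun (hω (Pi.single i 1) (by simp [Pi.single_apply, h])) i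

/-- The right-hand side of the uncontrolled system. -/
abbrev drift : Phase N →L[ℝ] Phase N := Matrix.toEuclideanCLM (𝕜 := ℝ) (matA ω)

lemma adjoint_drift_apply_zero (p : Phase N) (i : Fin N) :
    (drift ω).adjoint p (0, i) = -ω i ^ 2 * p (1, i) := by
  rw [← ContinuousLinearMap.star_eq_adjoint, ← map_star, Matrix.ofLp_toEuclideanCLM]
  simp [matA, Matrix.mulVec, dotProduct, Fintype.sum_prod_type, Matrix.blockDiagonal_apply]

lemma adjoint_drift_apply_one (p : Phase N) (i : Fin N) :
    (drift ω).adjoint p (1, i) = p (0, i) := by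
  rw [← ContinuousLinearMap.star_eq_adjoint, ← map_star, Matrix.ofLp_toEuclideanCLM]
  simp [matA, Matrix.mulVec, dotProduct, Fintype.sum_prod_type, Matrix.blockDiagonal_apply]

/-- The numbers `η i + I ξ i / ω i`: their moduli are the amplitudes `z i`, and the costate
equation multiplies them by `exp (I ω i t)`. -/
def complexAmplitude : Phase N →ₗ[ℝ] (Fin N → ℂ) where
  toFun p i := ⟨p (1, i), p (0, i) / ω i⟩
  map_add' p q := by ext i; simp [Complex.ext_iff, add_div]
  map_smul' r p := by ext i; simp [Complex.ext_iff, mul_div_assoc]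

lemma norm_complexAmplitude (p : Phase N) (i : Fin N) :
    ‖complexAmplitude ω p i‖ = amplitude ω p i := by
  rw [Complex.norm_eq_sqrt_sq_add_sq, amplitude]
  congr 2
  simp only [complexAmplitude, LinearMap.coe_mk, AddHom.coe_mk]
  ring

/-- The function on the torus whose restriction to the line `t ↦ ω t` is the switching function
`(B, p(t))` along the costate flow starting from `p`. -/
def switchingWave : Phase N →L[ℝ] C(UnitAddTorus (Fin N), ℝ) :=
  (wave ∘ₗ complexAmplitude ω).toContinuousLinearMap

lemma switchingWave_apply (p : Phase N) : switchingWave ω p = wave (complexAmplitude ω p) := rfl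

/-- `supportΩ` as a seminorm. -/
def supportSeminorm : Seminorm ℝ (Phase N) := (l1Seminorm volume).comp (switchingWave ω).toLinearMap

lemma supportSeminorm_apply (p : Phase N) :
    supportSeminorm ω p = l1Seminorm volume (switchingWave ω p) := rfl

lemma supportSeminorm_eq_integral (p : Phase N) :
    supportSeminorm ω p = ∫ x, |switchingWave ω p| x :=
  l1Seminorm_apply _

lemma coe_supportSeminorm : ⇑(supportSeminorm ω) = supportΩ ω := by
  funext p
  rw [supportSeminorm_apply, switchingWave_apply, l1Seminorm_wave_eq_box, supportΩ, torusAverage,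
    Fintype.card_fin]
  simp only [norm_complexAmplitude]

lemma rho_eq_gauge_polarBody (x : Phase N) : rho ω x = gauge (polarBody (supportSeminorm ω)) x := by
  simp only [rho, bodyΩ, polarBody, coe_supportSeminorm]

lemma inner_vecB (p : Phase N) : inner ℝ (vecB N) p = switchingWave ω p 0 := by
  simp [vecB, switchingWave_apply, wave_apply, complexAmplitude, PiLp.inner_apply,
    Fintype.sum_prod_type]

variable {ω}

lemma complexAmplitude_ne_zero (hω : ∀ i, ω i ≠ 0) {p : Phase N} (hp : p ≠ 0) :
    complexAmplitude ω p ≠ 0 := by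
  refine fun h => hp ?_
  ext ⟨k, i⟩
  have hi := Complex.ext_iff.1 (congrFun h i)
  simp only [complexAmplitude, LinearMap.coe_mk, AddHom.coe_mk, Pi.zero_apply, Complex.zero_re,
    Complex.zero_im, div_eq_zero_iff, hω i, or_false] at hi
  fin_cases k
  exacts [hi.2, hi.1]

lemma supportSeminorm_pos (hω : ∀ i, ω i ≠ 0) (p : Phase N) (hp : p ≠ 0) :
    0 < supportSeminorm ω p :=
  l1Seminorm_wave_pos (complexAmplitude_ne_zero hω hp)

lemma differentiableAt_supportSeminorm (hω : ∀ i, ω i ≠ 0) {p : Phase N} (hp : p ≠ 0) :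
    DifferentiableAt ℝ (supportSeminorm ω) p :=
  differentiableAt_l1Seminorm_comp _ (ae_wave_ne_zero (complexAmplitude_ne_zero hω hp))

lemma complexAmplitude_adjointFlow (hω : ∀ i, ω i ≠ 0) (t : ℝ) (p : Phase N) (i : Fin N) :
    complexAmplitude ω (adjointFlow (drift ω) t p) i =
      complexAmplitude ω p i * Complex.exp (t * ω i * Complex.I) := by
  refine map_adjointFlow_eq_exp_mul
    (ℓ := (LinearMap.proj i ∘ₗ complexAmplitude ω).toContinuousLinearMap) (fun q => ?_) t p
  have hdiv : ω i ^ 2 * q (1, i) / ω i = ω i * q (1, i) := by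
    rw [sq, mul_assoc, mul_div_cancel_left₀ _ (hω i)]
  simp [Complex.ext_iff, complexAmplitude, adjoint_drift_apply_zero, adjoint_drift_apply_one,
    hdiv, mul_div_cancel₀, hω i]

lemma switchingWave_adjointFlow (hω : ∀ i, ω i ≠ 0) (t : ℝ) (p : Phase N)
    (x : UnitAddTorus (Fin N)) :
    switchingWave ω (adjointFlow (drift ω) t p) x = switchingWave ω p (x + toTorus (t • ω)) := by
  simp only [switchingWave_apply, wave_add_toTorus]
  congr 1
  congr 1
  funext i
  simp [complexAmplitude_adjointFlow hω]

lemma supportSeminorm_adjointFlow (hω : ∀ i, ω i ≠ 0) (t : ℝ) (p : Phase N) :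
    supportSeminorm ω (adjointFlow (drift ω) t p) = supportSeminorm ω p := by
  simp only [supportSeminorm_apply, l1Seminorm_apply, switchingWave_adjointFlow hω]
  exact integral_add_right_eq_self (fun x => |switchingWave ω p x|) _

lemma inner_vecB_adjointFlow (hω : ∀ i, ω i ≠ 0) (t : ℝ) (p : Phase N) :
    inner ℝ (vecB N) (adjointFlow (drift ω) t p) = switchingWave ω p (toTorus (t • ω)) := by
  rw [inner_vecB ω, switchingWave_adjointFlow hω, zero_add]

lemma exists_abs_inner_vecB_le (hω : ∀ i, ω i ≠ 0) :
    ∃ K > 0, ∀ p, |inner ℝ (vecB N) p| ≤ K * supportSeminorm ω p := by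
  obtain ⟨m, hm, h⟩ := exists_pos_mul_norm_le_seminorm (supportSeminorm_pos hω)
  refine ⟨(‖vecB N‖ + 1) / m, by positivity, fun p => (abs_real_inner_le_norm _ _).trans ?_⟩
  rw [div_mul_eq_mul_div, le_div_iff₀ hm]
  nlinarith [h p, norm_nonneg (vecB N), norm_nonneg p, apply_nonneg (supportSeminorm ω) p]

lemma isMomentum_of_inner_eq_rho (hω : ∀ i, ω i ≠ 0) {x q : Phase N} (hx : 0 < rho ω x)
    (hq : supportSeminorm ω q ≤ 1) (h : inner ℝ x q = rho ω x) : IsMomentum ω x q := by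
  have hq0 : q ≠ 0 := by
    rintro rfl
    exact hx.ne (by simpa using h)
  rw [IsMomentum, rho_eq_gauge_polarBody, ← coe_supportSeminorm]
  rw [rho_eq_gauge_polarBody] at h hx
  exact ⟨hq0, hasGradientAt_of_inner_eq_gauge_polarBody (supportSeminorm_pos hω)
    (differentiableAt_supportSeminorm hω hq0) hx hq h⟩

/-- Equality in the triangle inequality makes the waves of `p` and `q` agree in sign on the whole
torus; a zero of the wave of `p` where that of `q` is nonzero would then be a local extremum. -/
theorem inner_vecB_mul_pos_of_add_eq (hω : ∀ i, ω i ≠ 0) {p q : Phase N} (hp : p ≠ 0)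
    (hq : inner ℝ (vecB N) q ≠ 0)
    (hadd : supportSeminorm ω (p + q) = supportSeminorm ω p + supportSeminorm ω q) :
    0 < inner ℝ (vecB N) p * inner ℝ (vecB N) q := by
  simp only [supportSeminorm_apply, map_add] at hadd
  have hmul := mul_nonneg_of_l1Seminorm_add hadd
  rw [inner_vecB ω] at hq ⊢
  rw [inner_vecB ω]
  refine (hmul 0).lt_of_ne' fun h0 => ?_
  have hWp : switchingWave ω p 0 = 0 := (mul_eq_zero.1 h0).resolve_right hq
  have hsign : ∀ᶠ y in 𝓝 0, 0 < switchingWave ω q y * switchingWave ω q 0 :=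
    ((switchingWave ω q).continuous.mul continuous_const).continuousAt.eventually
      (lt_mem_nhds (mul_self_pos.2 hq))
  have hzero := eq_zero_of_wave_nonneg (c := switchingWave ω q 0 • complexAmplitude ω p) (x := 0)
    (by simp [← switchingWave_apply, hWp]) <| by
      filter_upwards [hsign] with y hy
      simp only [map_smul, ← switchingWave_apply, ContinuousMap.smul_apply, smul_eq_mul]
      nlinarith [mul_nonneg (hmul y) hy.le, sq_pos_of_ne_zero (left_ne_zero_of_mul hy.ne')]
  exact complexAmplitude_ne_zero hω hp ((smul_eq_zero.1 hzero).resolve_left hq)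

theorem exists_pos_inner_vecB_mul_pos (hω : ∀ i, ω i ≠ 0) {δ : ℝ} (hδ : 0 < δ) :
    ∃ γ > 0, ∀ p q, supportSeminorm ω p ≤ 1 → supportSeminorm ω q ≤ 1 →
      2 - γ < supportSeminorm ω (p + q) → δ ≤ |inner ℝ (vecB N) q| →
        0 < inner ℝ (vecB N) p * inner ℝ (vecB N) q := by
  set H := supportSeminorm ω
  have hH : Continuous H := continuous_seminorm H
  have hcompact := isCompact_seminorm_le_one (supportSeminorm_pos hω)
  have hclosed : IsClosed {z : Phase N × Phase N |
      δ ≤ |inner ℝ (vecB N) z.2| ∧ inner ℝ (vecB N) z.1 * inner ℝ (vecB N) z.2 ≤ 0} :=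
    IsClosed.and (isClosed_le (by fun_prop) (by fun_prop)) (isClosed_le (by fun_prop) (by fun_prop))
  have hK := (hcompact.prod hcompact).inter_right hclosed
  obtain ⟨γ, hγ, hle⟩ := hK.exists_forall_le' (f := fun z => 2 - H (z.1 + z.2)) (a := 0)
    (by fun_prop) <| by
      rintro ⟨p, q⟩ ⟨⟨hp : H p ≤ 1, hq : H q ≤ 1⟩, hBq, hle⟩
      by_contra! hlt
      dsimp only at hBq hle hlt
      have hadd := map_add_le_add H p q
      refine hle.not_gt (inner_vecB_mul_pos_of_add_eq hω ?_ (abs_pos.1 (hδ.trans_le hBq))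
        (hadd.antisymm (by linarith)))
      rintro rfl
      linarith [map_zero H]
  refine ⟨γ, hγ, fun p q hp hq hpq hBq => ?_⟩
  by_contra! hneg
  linarith [hle (p, q) ⟨⟨hp, hq⟩, hBq, hneg⟩]

theorem exists_abs_integral_abs_inner_vecB_sub_le (hω : NonResonant ω) {ε : ℝ} (hε : 0 < ε) :
    ∃ L₀ > 0, ∀ a b, L₀ ≤ b - a → ∀ p, supportSeminorm ω p ≤ 1 →
      |(∫ t in a..b, |inner ℝ (vecB N) (adjointFlow (drift ω) t p)|) -
        (b - a) * supportSeminorm ω p| ≤ ε * (b - a) := by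
  have hK := (isCompact_seminorm_le_one (supportSeminorm_pos hω.ne_zero)).image
    (f := fun p => |switchingWave ω p|)
    ((ContinuousMap.continuous_postcomp ⟨abs, continuous_abs⟩).comp
      (switchingWave ω).continuous)
  have hunif := Metric.tendstoUniformlyOn_iff.1
    (tendstoUniformlyOn_interval_average_torus hω 0 hK) ε hε
  obtain ⟨L₀, hL₀⟩ := eventually_atTop.1 (hunif.and (eventually_gt_atTop 0))
  refine ⟨L₀, (hL₀ L₀ le_rfl).2, fun a b hab p hp => ?_⟩
  obtain ⟨hmean, hpos⟩ := hL₀ (b - a) hab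
  set q := adjointFlow (drift ω) a p
  have hq : supportSeminorm ω q = supportSeminorm ω p := supportSeminorm_adjointFlow hω.ne_zero a p
  have hshift : ∫ t in a..b, |inner ℝ (vecB N) (adjointFlow (drift ω) t p)| =
      ∫ t in 0..b - a, |switchingWave ω q| (0 + toTorus (t • ω)) := by
    have h := intervalIntegral.integral_comp_add_right (a := 0) (b := b - a)
      (fun t => |inner ℝ (vecB N) (adjointFlow (drift ω) t p)|) a
    rw [zero_add, sub_add_cancel] at h
    rw [← h]
    simp only [adjointFlow_add, inner_vecB_adjointFlow hω.ne_zero, zero_add]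
    rfl
  have h := hmean |switchingWave ω q| ⟨q, hq.trans_le hp, rfl⟩
  rw [interval_average_eq, ← hshift, sub_zero, dist_comm, Real.dist_eq, smul_eq_mul,
    ← supportSeminorm_eq_integral] at h
  calc _ = (b - a) * |(b - a)⁻¹ * (∫ t in a..b, |inner ℝ (vecB N) (adjointFlow (drift ω) t p)|) -
        supportSeminorm ω q| := by
        rw [← abs_of_pos hpos, ← abs_mul, abs_of_pos hpos, mul_sub,
          mul_inv_cancel_left₀ hpos.ne', hq]
    _ ≤ ε * (b - a) := by
        rw [mul_comm ε]
        exact mul_le_mul_of_nonneg_left h.le hpos.le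

end Oscillator

section Control

variable {N : ℕ} {ω : Fin N → ℝ}

lemma exists_inner_adjointFlow_eq_rho (hω : ∀ i, ω i ≠ 0) (x : Phase N) (t : ℝ) :
    ∃ p, supportSeminorm ω p ≤ 1 ∧ inner ℝ x (adjointFlow (drift ω) t p) = rho ω x := by
  obtain ⟨q, hq, h⟩ := exists_inner_eq_gauge_polarBody (supportSeminorm_pos hω) x
  refine ⟨adjointFlow (drift ω) (-t) q, (supportSeminorm_adjointFlow hω _ _).trans_le hq, ?_⟩
  rw [← adjointFlow_add, add_neg_cancel, adjointFlow_zero, h, rho_eq_gauge_polarBody]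

lemma inner_le_rho_mul (hω : ∀ i, ω i ≠ 0) (x p : Phase N) :
    inner ℝ x p ≤ rho ω x * supportSeminorm ω p := by
  rw [rho_eq_gauge_polarBody]
  exact inner_le_gauge_polarBody_mul (supportSeminorm_pos hω) x p

lemma inner_adjointFlow_le_rho (hω : ∀ i, ω i ≠ 0) {p : Phase N} (hp : supportSeminorm ω p ≤ 1)
    (x : Phase N) (t : ℝ) : inner ℝ x (adjointFlow (drift ω) t p) ≤ rho ω x :=
  (inner_le_rho_mul hω x _).trans <| mul_le_of_le_one_right (gauge_nonneg _)
    ((supportSeminorm_adjointFlow hω t p).trans_le hp)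

lemma supportSeminorm_eq_one (hω : ∀ i, ω i ≠ 0) {x p : Phase N} {t : ℝ} (hx : 0 < rho ω x)
    (hp : supportSeminorm ω p ≤ 1) (h : inner ℝ x (adjointFlow (drift ω) t p) = rho ω x) :
    supportSeminorm ω p = 1 := by
  rw [rho_eq_gauge_polarBody] at h hx
  rw [← supportSeminorm_adjointFlow hω t p] at hp ⊢
  exact eq_one_of_inner_eq_gauge_polarBody (supportSeminorm_pos hω) hx hp h

theorem exists_pos_mul_inner_vecB_le (hω : ∀ i, ω i ≠ 0) {δ : ℝ} (hδ : 0 < δ) :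
    ∃ γ > 0, ∀ (x p : Phase N) (v : ℝ), 0 < rho ω x → supportSeminorm ω p ≤ 1 →
      (1 - γ) * rho ω x < inner ℝ x p → |v| ≤ 1 →
      (∀ q, IsMomentum ω x q → inner ℝ (vecB N) q ≠ 0 → v = -Real.sign (inner ℝ (vecB N) q)) →
        v * inner ℝ (vecB N) p ≤ -|inner ℝ (vecB N) p| + δ := by
  obtain ⟨γ, hγ, hsign⟩ := exists_pos_inner_vecB_mul_pos hω (half_pos hδ)
  refine ⟨γ, hγ, fun x p v hx hp hxp hv hfb => ?_⟩
  obtain hsmall | hlarge := lt_or_ge |inner ℝ (vecB N) p| (δ / 2)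
  · have hle : v * inner ℝ (vecB N) p ≤ |inner ℝ (vecB N) p| :=
      (le_abs_self _).trans (by rw [abs_mul]; exact mul_le_of_le_one_left (abs_nonneg _) hv)
    linarith
  obtain ⟨q, hq, hxq⟩ := exists_inner_adjointFlow_eq_rho hω x 0
  rw [adjointFlow_zero] at hxq
  have hclose : 2 - γ < supportSeminorm ω (q + p) := by
    refine lt_of_mul_lt_mul_left (lt_of_lt_of_le ?_ (inner_le_rho_mul hω x (q + p))) hx.le
    rw [inner_add_right, hxq]
    linarith
  have hpos := hsign q p hq hp hclose hlarge
  have hv' := hfb q (isMomentum_of_inner_eq_rho hω hx hq hxq) (left_ne_zero_of_mul hpos.ne')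
  obtain ⟨hq0, hp0⟩ | ⟨hq0, hp0⟩ := mul_pos_iff.1 hpos
  · rw [hv', Real.sign_of_pos hq0, abs_of_pos hp0]
    linarith
  · rw [hv', Real.sign_of_neg hq0, abs_of_neg hp0]
    linarith

lemma continuous_inner_vecB_adjointFlow (ω : Fin N → ℝ) (p : Phase N) :
    Continuous fun t => inner ℝ (vecB N) (adjointFlow (drift ω) t p) :=
  continuous_const.inner (continuous_adjointFlow _ p)

namespace IsMotion

variable {T : ℝ} {x : ℝ → Phase N} {u : ℝ → ℝ} {a b : ℝ}

lemma intervalIntegrable (h : IsMotion ω T x u) (ha : a ∈ Set.Icc 0 T) (hb : b ∈ Set.Icc 0 T) :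
    IntervalIntegrable u volume a b := by
  have hint : IntegrableOn u (Set.Icc 0 T) :=
    .of_bound (by simp) h.aemeasurable.aestronglyMeasurable 1 h.abs_le_one
  exact (hint.mono_set (Set.uIcc_subset_Icc ha hb)).intervalIntegrable

lemma inner_adjointFlow_sub (h : IsMotion ω T x u) (ha : a ∈ Set.Icc 0 T) (hb : b ∈ Set.Icc 0 T)
    (p : Phase N) :
    inner ℝ (x b) (adjointFlow (drift ω) b p) - inner ℝ (x a) (adjointFlow (drift ω) a p) =
      ∫ r in a..b, u r * inner ℝ (vecB N) (adjointFlow (drift ω) r p) := by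
  have hsub := Set.uIcc_subset_Icc ha hb
  have hint : ∀ s ∈ Set.Icc 0 T, ∀ t ∈ Set.Icc 0 T,
      IntervalIntegrable (fun τ => drift ω (x τ) + u τ • vecB N) volume s t := fun s hs t ht =>
    ((drift ω).continuous.comp_continuousOn
      (h.continuousOn.mono (Set.uIcc_subset_Icc hs ht))).intervalIntegrable.add
      ⟨(h.intervalIntegrable hs ht).1.smul_const _, (h.intervalIntegrable hs ht).2.smul_const _⟩
  have h0 : 0 ∈ Set.Icc 0 T := ⟨le_rfl, ha.1.trans ha.2⟩
  refine inner_adjointFlow_sub_inner_adjointFlow (h.continuousOn.mono hsub)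
    (h.intervalIntegrable ha hb) (fun r hr => ?_) p
  rw [h.eq_integral r (hsub hr), h.eq_integral a ha, add_assoc,
    intervalIntegral.integral_add_adjacent_intervals (hint 0 h0 a ha) (hint a ha r (hsub hr))]

lemma abs_inner_adjointFlow_sub_le (h : IsMotion ω T x u) (ha : 0 ≤ a) (hab : a ≤ b) (hb : b ≤ T)
    (p : Phase N) :
    |inner ℝ (x b) (adjointFlow (drift ω) b p) - inner ℝ (x a) (adjointFlow (drift ω) a p)| ≤
      ∫ r in a..b, |inner ℝ (vecB N) (adjointFlow (drift ω) r p)| := by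
  rw [h.inner_adjointFlow_sub ⟨ha, hab.trans hb⟩ ⟨ha.trans hab, hb⟩, ← Real.norm_eq_abs]
  refine intervalIntegral.norm_integral_le_of_norm_le hab ?_
    ((continuous_inner_vecB_adjointFlow ω p).abs.intervalIntegrable a b)
  filter_upwards [(ae_restrict_iff' measurableSet_Icc).1 h.abs_le_one] with r hr hmem
  rw [Real.norm_eq_abs, abs_mul]
  exact mul_le_of_le_one_left (abs_nonneg _) (hr ⟨ha.trans hmem.1.le, hmem.2.trans hb⟩)

lemma abs_inner_adjointFlow_sub_le_mul (hω : ∀ i, ω i ≠ 0) {K : ℝ} (hK0 : 0 ≤ K)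
    (hK : ∀ p, |inner ℝ (vecB N) p| ≤ K * supportSeminorm ω p) (h : IsMotion ω T x u) (ha : 0 ≤ a)
    (hab : a ≤ b) (hb : b ≤ T) {p : Phase N} (hp : supportSeminorm ω p ≤ 1) :
    |inner ℝ (x b) (adjointFlow (drift ω) b p) - inner ℝ (x a) (adjointFlow (drift ω) a p)| ≤
      K * (b - a) := by
  have hbound : ∀ r, |inner ℝ (vecB N) (adjointFlow (drift ω) r p)| ≤ K := fun r => by
    refine (hK _).trans (mul_le_of_le_one_right hK0 ?_)
    rwa [supportSeminorm_adjointFlow hω]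
  calc _ ≤ ∫ r in a..b, |inner ℝ (vecB N) (adjointFlow (drift ω) r p)| :=
        h.abs_inner_adjointFlow_sub_le ha hab hb p
    _ ≤ ∫ _ in a..b, K := intervalIntegral.integral_mono_on hab
        ((continuous_inner_vecB_adjointFlow ω p).abs.intervalIntegrable a b)
        intervalIntegrable_const fun r _ => hbound r
    _ = K * (b - a) := by rw [intervalIntegral.integral_const, smul_eq_mul, mul_comm]

/-- The radial coordinate varies at bounded speed, so far from the origin its relative variation
on a short time interval is small. -/
theorem exists_forall_lt_inner_adjointFlow (hω : ∀ i, ω i ≠ 0) {γ L : ℝ} (hγ : 0 < γ)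
    (hL : 0 ≤ L) :
    ∃ R > 0, ∀ {T x u a b p}, IsMotion ω T x u → 0 ≤ a → b ≤ T → b - a ≤ L → R ≤ rho ω (x b) →
      supportSeminorm ω p ≤ 1 → inner ℝ (x b) (adjointFlow (drift ω) b p) = rho ω (x b) →
      ∀ s ∈ Set.Icc a b, 0 < rho ω (x s) ∧
        (1 - γ) * rho ω (x s) < inner ℝ (x s) (adjointFlow (drift ω) s p) := by
  obtain ⟨K, hK0, hK⟩ := exists_abs_inner_vecB_le hω
  refine ⟨K * L + 2 * (K * L) / γ + 1, by positivity, ?_⟩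
  intro T x u a b p h ha hb hab hR hp hxb s hs
  have hlen : K * (b - s) ≤ K * L := mul_le_mul_of_nonneg_left (by linarith [hs.1]) hK0.le
  have hvar : ∀ q, supportSeminorm ω q ≤ 1 → |inner ℝ (x b) (adjointFlow (drift ω) b q) -
      inner ℝ (x s) (adjointFlow (drift ω) s q)| ≤ K * L := fun q hq =>
    (h.abs_inner_adjointFlow_sub_le_mul hω hK0.le hK (ha.trans hs.1) hs.2 hb hq).trans hlen
  obtain ⟨q, hq, hxs⟩ := exists_inner_adjointFlow_eq_rho hω (x s) s
  have hlower := (abs_le.1 (hvar p hp)).2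
  have hupper := (abs_le.1 (hvar q hq)).1
  have hpos : 0 < 2 * (K * L) / γ + 1 := by positivity
  have hps := inner_adjointFlow_le_rho hω hp (x s) s
  have hqb := inner_adjointFlow_le_rho hω hq (x b) b
  have hγs : 2 * (K * L) < rho ω (x s) * γ := (div_lt_iff₀ hγ).1 (by linarith)
  exact ⟨by linarith, by linarith⟩

end IsMotion

theorem exists_forall_rho_sub_rho_le (hω : NonResonant ω) {ε : ℝ} (hε : 0 < ε) :
    ∃ L₀ > 0, ∀ {T x u}, IsMotion ω T x u → L₀ ≤ T →
      rho ω (x 0) - rho ω (x T) ≤ (1 + ε) * T := by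
  obtain ⟨L₀, hL₀, hmean⟩ := exists_abs_integral_abs_inner_vecB_sub_le hω hε
  refine ⟨L₀, hL₀, fun {T x u} h hT => ?_⟩
  have hT0 : 0 ≤ T := hL₀.le.trans hT
  obtain ⟨p, hp, hx0⟩ := exists_inner_adjointFlow_eq_rho hω.ne_zero (x 0) 0
  have hxT := inner_adjointFlow_le_rho hω.ne_zero hp (x T) T
  have hvar := (abs_le.1 (h.abs_inner_adjointFlow_sub_le le_rfl hT0 le_rfl p)).1
  have hint := (abs_le.1 (hmean 0 T (by rwa [sub_zero]) p hp)).2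
  rw [sub_zero] at hint
  have hTp : T * supportSeminorm ω p ≤ T := mul_le_of_le_one_right hT0 hp
  linarith

theorem exists_forall_window_decrease (hω : NonResonant ω) {ε : ℝ} (hε : 0 < ε) :
    ∃ L > 0, ∃ R, ∀ {T x u a b}, IsFeedbackMotion ω T x u → 0 ≤ a → b ≤ T → L ≤ b - a →
      b - a ≤ 2 * L → R ≤ rho ω (x b) → rho ω (x b) + (1 - ε) * (b - a) ≤ rho ω (x a) := by
  obtain ⟨L, hL, hmean⟩ := exists_abs_integral_abs_inner_vecB_sub_le hω (half_pos hε)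
  obtain ⟨γ, hγ, hsign⟩ := exists_pos_mul_inner_vecB_le hω.ne_zero (half_pos hε)
  obtain ⟨R, hR, hnear⟩ :=
    IsMotion.exists_forall_lt_inner_adjointFlow hω.ne_zero hγ (L := 2 * L) (by positivity)
  refine ⟨L, hL, R, fun {T x u a b} h ha hb hab hab' hRb => ?_⟩
  have hle : a ≤ b := by linarith
  obtain ⟨p, hp, hxb⟩ := exists_inner_adjointFlow_eq_rho hω.ne_zero (x b) b
  let g : ℝ → ℝ := fun s => inner ℝ (vecB N) (adjointFlow (drift ω) s p)
  have hg : Continuous g := continuous_inner_vecB_adjointFlow ω p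
  have hcontrol : ∀ᵐ s ∂volume.restrict (Set.Icc a b), u s * g s ≤ -|g s| + ε / 2 := by
    have hsub : Set.Icc a b ⊆ Set.Icc 0 T := Set.Icc_subset_Icc ha hb
    filter_upwards [ae_restrict_of_ae_restrict_of_subset hsub h.abs_le_one,
      ae_restrict_of_ae_restrict_of_subset hsub h.feedback, ae_restrict_mem measurableSet_Icc]
      with s hu hfb hs
    obtain ⟨hpos, hlt⟩ := hnear h.toIsMotion ha hb hab' hRb hp hxb s hs
    refine hsign (x s) _ (u s) hpos ?_ hlt hu hfb
    rwa [supportSeminorm_adjointFlow hω.ne_zero]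
  have hug : IntervalIntegrable (fun s => u s * g s) volume a b :=
    (h.intervalIntegrable ⟨ha, hle.trans hb⟩ ⟨ha.trans hle, hb⟩).mul_continuousOn hg.continuousOn
  have habs : IntervalIntegrable (fun s => -|g s|) volume a b := hg.abs.neg.intervalIntegrable a b
  have hxa := inner_adjointFlow_le_rho hω.ne_zero hp (x a) a
  have hint := (abs_le.1 (hmean a b hab p hp)).1
  rw [supportSeminorm_eq_one hω.ne_zero (hR.trans_le hRb) hp hxb, mul_one] at hint
  have hpair : rho ω (x b) - inner ℝ (x a) (adjointFlow (drift ω) a p) ≤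
      -(∫ s in a..b, |g s|) + ε / 2 * (b - a) := by
    calc _ = ∫ s in a..b, u s * g s := by
          rw [← hxb]
          exact h.inner_adjointFlow_sub ⟨ha, hle.trans hb⟩ ⟨ha.trans hle, hb⟩ p
      _ ≤ ∫ s in a..b, (-|g s| + ε / 2) := intervalIntegral.integral_mono_ae_restrict hle hug
          (habs.add intervalIntegrable_const) hcontrol
      _ = _ := by
          rw [intervalIntegral.integral_add habs intervalIntegrable_const,
            intervalIntegral.integral_neg, intervalIntegral.integral_const, smul_eq_mul,
            mul_comm (b - a)]
  linarith

lemma add_mul_sub_le_of_forall_window {f : ℝ → ℝ} {s t L R c : ℝ} (hL : 0 < L) (hc : 0 ≤ c)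
    (hf : ∀ a b, s ≤ a → b ≤ t → L ≤ b - a → b - a ≤ 2 * L → R ≤ f b → f b + c * (b - a) ≤ f a)
    (hst : L ≤ t - s) (hR : R ≤ f t) : f t + c * (t - s) ≤ f s := by
  have hind : ∀ n : ℕ, ∀ b ≤ t, L ≤ b - s → b - s ≤ (n + 2) * L → R ≤ f b →
      f b + c * (b - s) ≤ f s := by
    intro n
    induction n with
    | zero => exact fun b hb hbs hbL => hf s b le_rfl hb hbs (by simpa using hbL)
    | succ n ih =>
      intro b hb hbs hbL hRb
      push_cast at hbL
      obtain hshort | hlong := le_or_gt (b - s) (2 * L)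
      · exact hf s b le_rfl hb hbs hshort hRb
      · have hlast := hf (b - L) b (by linarith) hb (by linarith) (by linarith) hRb
        have hcL : 0 ≤ c * L := mul_nonneg hc hL.le
        have hrest := ih (b - L) (by linarith) (by linarith) (by linarith) (by linarith)
        linarith
  obtain ⟨n, hn⟩ := exists_nat_ge ((t - s) / L)
  rw [div_le_iff₀ hL] at hn
  exact hind n t le_rfl hst (by linarith) hR

theorem exists_forall_le_rho_sub_rho (hω : NonResonant ω) {ε : ℝ} (hε : 0 < ε) :
    ∃ M, ∀ {T x u}, IsFeedbackMotion ω T x u → M ≤ rho ω (x T) → M ≤ T →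
      (1 - ε) * T ≤ rho ω (x 0) - rho ω (x T) := by
  obtain ⟨L, hL, R, hwindow⟩ := exists_forall_window_decrease hω (lt_min hε one_pos)
  refine ⟨max L R, fun {T x u} h hρ hT => ?_⟩
  have hLT : L ≤ T := (le_max_left L R).trans hT
  have hdec := add_mul_sub_le_of_forall_window (f := fun t => rho ω (x t)) (s := 0) hL
    (sub_nonneg.2 (min_le_right ε 1)) (fun a b => hwindow h) (by rwa [sub_zero])
    ((le_max_right L R).trans hρ)
  have hmin : min ε 1 * T ≤ ε * T :=
    mul_le_mul_of_nonneg_right (min_le_left ε 1) (hL.le.trans hLT)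
  linarith

end Control

end Oscillators

end

theorem theorem1_general {N : ℕ} (ω : Fin N → ℝ) (hω : Oscillators.NonResonant ω) :
    (∀ ε : ℝ, 0 < ε → ∃ M₀ : ℝ, ∀ (T : ℝ) (x : ℝ → Oscillators.Phase N) (u : ℝ → ℝ),
      Oscillators.IsFeedbackMotion ω T x u → M₀ ≤ Oscillators.rho ω (x T) → M₀ ≤ T →
        |(Oscillators.rho ω (x 0) - Oscillators.rho ω (x T)) / T - 1| ≤ ε) ∧
    (∀ ε : ℝ, 0 < ε → ∃ M₀ : ℝ, ∀ (T : ℝ) (x : ℝ → Oscillators.Phase N) (u : ℝ → ℝ),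
      Oscillators.IsMotion ω T x u → M₀ ≤ T →
        (Oscillators.rho ω (x 0) - Oscillators.rho ω (x T)) / T ≤ 1 + ε) := by
  refine ⟨fun ε hε => ?_, fun ε hε => ?_⟩ <;>
    obtain ⟨L₀, hL₀, hupper⟩ := Oscillators.exists_forall_rho_sub_rho_le hω hε
  · obtain ⟨M, hlower⟩ := Oscillators.exists_forall_le_rho_sub_rho hω hε
    refine ⟨max L₀ M, fun T x u h hρ hT => ?_⟩
    have hLT : L₀ ≤ T := (le_max_left L₀ M).trans hT
    have hT0 : 0 < T := hL₀.trans_le hLT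
    have hup := hupper h.toIsMotion hLT
    have hlow := hlower h ((le_max_right L₀ M).trans hρ) ((le_max_right L₀ M).trans hT)
    rw [← div_le_iff₀ hT0] at hup
    rw [← le_div_iff₀ hT0] at hlow
    rw [abs_sub_le_iff]
    exact ⟨by linarith, by linarith⟩
  · exact ⟨L₀, fun T x u h hT => (div_le_iff₀ (hL₀.trans_le hT)).2 (hupper h hT)⟩

theorem theorem1 {N : ℕ} (ω : Fin N → ℝ) (hpos : ∀ i, 0 < ω i)
    (hω : Oscillators.NonResonant ω) :
    (∀ ε : ℝ, 0 < ε → ∃ M₀ : ℝ, ∀ (T : ℝ) (x : ℝ → Oscillators.Phase N) (u : ℝ → ℝ),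
      Oscillators.IsFeedbackMotion ω T x u →
      M₀ ≤ min (min (Oscillators.rho ω (x 0)) (Oscillators.rho ω (x T))) T →
      |(Oscillators.rho ω (x 0) - Oscillators.rho ω (x T)) / T - 1| ≤ ε) ∧
    (∀ ε : ℝ, 0 < ε → ∃ M₀ : ℝ, ∀ (T : ℝ) (x : ℝ → Oscillators.Phase N) (u : ℝ → ℝ),
      Oscillators.IsMotion ω T x u →
      M₀ ≤ min (min (Oscillators.rho ω (x 0)) (Oscillators.rho ω (x T))) T →
      (Oscillators.rho ω (x 0) - Oscillators.rho ω (x T)) / T ≤ 1 + ε) := by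
  simp only [le_min_iff]
  exact (theorem1_general ω hω).imp
    (fun h ε hε => (h ε hε).imp fun _ h T x u hx hM => h T x u hx hM.1.2 hM.2)
    (fun h ε hε => (h ε hε).imp fun _ h T x u hx hM => h T x u hx hM.2)
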